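/- Let $K\ge 2$, and let $n_t,n_r\ge 1$ be the numbers of transmit antennas of each user and of receive antennas. For $k\in\mathcal K=\{1,\dots,K\}$ let $\mathbf H_k=\mathbf V_k\tilde{\mathbf H}_k\mathbf W_k\in\mathbb C^{n_r\times n_t}$ be the random channel matrix of user $k$, where $\mathbf V_k$ and $\mathbf W_k$ are deterministic unitary matrices (in particular, all $\mathbf V_k$ may be equal), and all entries of all the matrices $\tilde{\mathbf H}_1,\dots,\tilde{\mathbf H}_K$ are independent zero-mean circularly symmetric complex Gaussian random variables with $\mathbb E|\tilde H_k(i,j)|^2=\sigma_k(i,j)/n_t$. Here the variance profile $\sigma_k(i,j)\ge 0$ is arbitrary, except that for each $k$ at least one $\sigma_k(i,j)$ is positive. Let $\rho=1/\sigma^2$ with noise variance $\sigma^2>0$, and let $\overline P_k\ge 0$. Consider the game with player set $\mathcal K$ in which user $k$ chooses a matrix from $$\mathcal A_k^{\mathrm{SUD}}=\left\{\mathbf Q_k\in\mathbb C^{n_t\times n_t}\;:\;\mathbf Q_k=\mathbf Q_k^H\succeq 0,\ \mathrm{Tr}(\mathbf Q_k)\le n_t\overline P_k\right\}$$ and has the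 payoff $$u_k^{\mathrm{SUD}}(\mathbf Q_k,\mathbf Q_{-k})=\mathbb E\log_2\Big|\mathbf I+\rho\mathbf H_k\mathbf Q_k\mathbf H_k^H+\rho\sum_{\ell\ne k}\mathbf H_\ell\mathbf Q_\ell\mathbf H_\ell^H\Big|-\mathbb E\log_2\Big|\mathbf I+\rho\sum_{\ell\ne k}\mathbf H_\ell\mathbf Q_\ell\mathbf H_\ell^H\Big| ,$$ where $|\cdot|$ is the determinant. Both expectations are finite for every $k$ and every profile $(\mathbf Q_1,\dots,\mathbf Q_K)$ with $\mathbf Q_\ell\in\mathcal A_\ell^{\mathrm{SUD}}$ for all $\ell$, and the game has exactly one Nash equilibrium: there is exactly one profile $(\mathbf Q_1^*,\dots,\mathbf Q_K^*)$ with $\mathbf Q_k^*\in\mathcal A_k^{\mathrm{SUD}}$ and $u_k^{\mathrm{SUD}}(\mathbf Q_k^*,\mathbf Q_{-k}^*)\ge u_k^{\mathrm{SUD}}(\mathbf Q_k,\mathbf Q_{-k}^*)$ for every $k\in\mathcal K$ and every $\mathbf Q_k\in\mathcal A_k^{\mathrm{SUD}}$. -/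

import Mathlib

open MeasureTheory ProbabilityTheory
open scoped NNReal Matrix ComplexOrder

noncomputable section

/-- A pure Nash equilibrium of the strategic game with player set `ι`, action sets `A i` and payoffs
`u i`: a feasible profile from which no player gains by a feasible unilateral deviation. -/
def IsNashEquilibrium {ι : Type*} [DecidableEq ι] {S : ι → Type*} (A : (i : ι) → Set (S i))
    (u : ι → ((i : ι) → S i) → ℝ) (a : (i : ι) → S i) : Prop :=
  (∀ i, a i ∈ A i) ∧ ∀ i, ∀ b ∈ A i, u i (Function.update a i b) ≤ u i a

/-- The centred circularly symmetric complex Gaussian law `z` with `E|z|² = v`: independent real and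
imaginary parts, each centred real Gaussian of variance `v / 2` (the Dirac mass at `0` if
`v = 0`). -/
def complexGaussian (v : ℝ≥0) : Measure ℂ :=
  ((gaussianReal 0 (v / 2)).prod (gaussianReal 0 (v / 2))).map
    (fun p : ℝ × ℝ => (p.1 : ℂ) + (p.2 : ℂ) * Complex.I)

/-- The channel matrices `V k * Htilde k * W k` (unitary-independent-unitary model). -/
def uiuChannel {K nr nt : ℕ} {Ω : Type*}
    (V : Fin K → Matrix.unitaryGroup (Fin nr) ℂ) (W : Fin K → Matrix.unitaryGroup (Fin nt) ℂ)
    (Htilde : Fin K → Ω → Matrix (Fin nr) (Fin nt) ℂ) :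
    Fin K → Ω → Matrix (Fin nr) (Fin nt) ℂ :=
  fun k ω => (V k : Matrix (Fin nr) (Fin nr) ℂ) * Htilde k ω * (W k : Matrix (Fin nt) (Fin nt) ℂ)

/-- The Gaussian fading hypothesis: all entries of all the matrices `Htilde k` are mutually
independent, and the entry `(i, j)` of `Htilde k` is a centred complex Gaussian with second absolute
moment `σ k i j / nt`. -/
structure IsGaussianFading {K nr nt : ℕ} {Ω : Type*} [MeasurableSpace Ω] (P : Measure Ω)
    (σ : Fin K → Fin nr → Fin nt → ℝ≥0)
    (Htilde : Fin K → Ω → Matrix (Fin nr) (Fin nt) ℂ) : Prop where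
  law : ∀ k i j, HasLaw (fun ω => Htilde k ω i j) (complexGaussian (σ k i j / (nt : ℝ≥0))) P
  indep : iIndepFun (fun (x : Fin K × Fin nr × Fin nt) (ω : Ω) => Htilde x.1 ω x.2.1 x.2.2) P

/-- The action set of a user with power `Pbar`: positive semidefinite Hermitian matrices of trace
at most `nt * Pbar`. -/
def sudActions (nt : ℕ) (Pbar : ℝ) : Set (Matrix (Fin nt) (Fin nt) ℂ) :=
  {Q | Q.PosSemidef ∧ Q.trace.re ≤ nt * Pbar}

/-- Interference plus noise (normalized by the noise power) seen by user `k` under single user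
decoding: `I + ρ ∑_{ℓ ≠ k} H_ℓ Q_ℓ H_ℓᴴ`. -/
def sudInterference {K nr nt : ℕ} (ρ : ℝ) (H : Fin K → Matrix (Fin nr) (Fin nt) ℂ)
    (Q : Fin K → Matrix (Fin nt) (Fin nt) ℂ) (k : Fin K) : Matrix (Fin nr) (Fin nr) ℂ :=
  1 + (ρ : ℂ) • ∑ l ∈ Finset.univ.erase k, H l * Q l * (H l)ᴴ

/-- `log₂ |M|` for a matrix whose determinant is a positive real number. -/
def logDet {nr : ℕ} (M : Matrix (Fin nr) (Fin nr) ℂ) : ℝ :=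
  Real.logb 2 M.det.re

/-- `ω ↦ log₂ |I + ρ H_k Q_k H_kᴴ + ρ ∑_{ℓ ≠ k} H_ℓ Q_ℓ H_ℓᴴ|`. -/
def sudTotalLogDet {K nr nt : ℕ} {Ω : Type*} (ρ : ℝ)
    (H : Fin K → Ω → Matrix (Fin nr) (Fin nt) ℂ)
    (Q : Fin K → Matrix (Fin nt) (Fin nt) ℂ) (k : Fin K) (ω : Ω) : ℝ :=
  logDet (sudInterference ρ (fun l => H l ω) Q k + (ρ : ℂ) • (H k ω * Q k * (H k ω)ᴴ))

/-- `ω ↦ log₂ |I + ρ ∑_{ℓ ≠ k} H_ℓ Q_ℓ H_ℓᴴ|`. -/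
def sudInterferenceLogDet {K nr nt : ℕ} {Ω : Type*} (ρ : ℝ)
    (H : Fin K → Ω → Matrix (Fin nr) (Fin nt) ℂ)
    (Q : Fin K → Matrix (Fin nt) (Fin nt) ℂ) (k : Fin K) (ω : Ω) : ℝ :=
  logDet (sudInterference ρ (fun l => H l ω) Q k)

/-- The ergodic single-user-decoding rate of user `k`. -/
def sudUtility {K nr nt : ℕ} {Ω : Type*} [MeasurableSpace Ω] (P : Measure Ω) (ρ : ℝ)
    (H : Fin K → Ω → Matrix (Fin nr) (Fin nt) ℂ) (k : Fin K)
    (Q : Fin K → Matrix (Fin nt) (Fin nt) ℂ) : ℝ :=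
  (∫ ω, sudTotalLogDet ρ H Q k ω ∂P) - ∫ ω, sudInterferenceLogDet ρ H Q k ω ∂P

end

/-! The interference term in a user's payoff does not depend on that user's own matrix. The ergodic
sum rate `sumRate` is therefore an exact potential (`sudUtility_eq`), and equilibria are the
feasible profiles maximal in each coordinate separately. A global maximizer exists because the sum
rate is continuous on a compact product; square-integrable channel entries supply the domination,
since `log det M ≤ tr (M - 1)`.

Uniqueness has two stages. Write `M`, `M'` for the received covariances of two equilibria. The
first-order conditions of all users, each tested against the other equilibrium, add up to `E tr
((M⁻¹ - M'⁻¹) (M' - M)) ≤ 0`. The integrand is nonnegative and vanishes only if `M = M'`, so `M =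
M'` almost surely (`IsNashEquilibrium.ae_receivedCovariance_eq`).

It remains to recover the inputs. The fading law charges every open set meeting the subspace cut out
by the variance profile, so the identity holds at every channel of that subspace
(`IsGaussianFading.eq_zero_of_ae_eq_zero`). Silencing the channels of all users but `k` gives `G E
Gᴴ = 0` for all admissible `G`, with `E = W_k (Q_k - Q'_k) W_kᴴ`, and polarization kills the entries
of `E` between active columns. In an inactive column an equilibrium spends no power, since that
power could be moved to an active one (`IsNashEquilibrium.conj_apply_self_re_eq_zero`); positivity
then kills the whole row and column. -/

section MatrixLemmas

/-! ### Trace and determinant inequalities for positive matrices. -/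

variable {n m : Type*} [Fintype n] [Fintype m]

lemma Matrix.PosSemidef.trace_re_nonneg {A : Matrix n n ℂ} (hA : A.PosSemidef) :
    0 ≤ A.trace.re :=
  (Complex.le_def.mp hA.trace_nonneg).1

lemma Matrix.PosSemidef.trace_eq_zero_of_re {A : Matrix n n ℂ} (hA : A.PosSemidef)
    (h : A.trace.re = 0) : A = 0 :=
  hA.trace_eq_zero_iff.mp
    (Complex.ext h ((Complex.le_def.mp hA.trace_nonneg).2.symm))

variable [DecidableEq n]

open scoped MatrixOrder Matrix.Norms.L2Operator in
lemma Matrix.PosSemidef.exists_eq_conjTranspose_mul_self {A : Matrix n n ℂ} (hA : A.PosSemidef) :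
    ∃ B : Matrix n n ℂ, A = Bᴴ * B :=
  CStarAlgebra.nonneg_iff_eq_star_mul_self.mp (Matrix.nonneg_iff_posSemidef.mpr hA)

lemma Matrix.PosSemidef.trace_mul_re_nonneg {A B : Matrix n n ℂ} (hA : A.PosSemidef)
    (hB : B.PosSemidef) : 0 ≤ (A * B).trace.re := by
  obtain ⟨C, rfl⟩ := hA.exists_eq_conjTranspose_mul_self
  rw [Matrix.mul_assoc, Matrix.trace_mul_comm]
  exact (hB.mul_mul_conjTranspose_same C).trace_re_nonneg

/-- With `X = A - 1`, one has `1 - A⁻¹ = A⁻¹ (X + X²) A⁻¹`. -/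
lemma Matrix.PosDef.posSemidef_one_sub_inv {A : Matrix n n ℂ} (hA : A.PosDef)
    (h : (A - 1).PosSemidef) : (1 - A⁻¹).PosSemidef := by
  have hu : IsUnit A.det := (Matrix.isUnit_iff_isUnit_det A).mp hA.isUnit
  have h2 : ((A - 1) * (A - 1)ᴴ).PosSemidef := Matrix.posSemidef_self_mul_conjTranspose _
  have h3 := (h.add h2).conjTranspose_mul_mul_same A⁻¹
  rw [h.isHermitian.eq, hA.inv.isHermitian.eq] at h3
  convert h3 using 1
  have : (A - 1) + (A - 1) * (A - 1) = (A - 1) * A := by noncomm_ring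
  rw [this, Matrix.mul_assoc, Matrix.mul_assoc, Matrix.mul_nonsing_inv _ hu, Matrix.mul_one,
    Matrix.mul_sub, Matrix.nonsing_inv_mul _ hu, Matrix.mul_one]

lemma Matrix.PosDef.trace_inv_mul_re_le {A X : Matrix n n ℂ} (hA : A.PosDef)
    (h : (A - 1).PosSemidef) (hX : X.PosSemidef) :
    (A⁻¹ * X).trace.re ≤ X.trace.re := by
  have := (hA.posSemidef_one_sub_inv h).trace_mul_re_nonneg hX
  rw [Matrix.sub_mul, Matrix.one_mul, Matrix.trace_sub, Complex.sub_re] at this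
  linarith

lemma Matrix.PosDef.det_re_pos {A : Matrix n n ℂ} (hA : A.PosDef) : 0 < A.det.re :=
  (Complex.lt_def.mp hA.det_pos).1

lemma Matrix.PosDef.det_eq_re {A : Matrix n n ℂ} (hA : A.PosDef) : A.det = (A.det.re : ℂ) :=
  Complex.ext rfl (Complex.lt_def.mp hA.det_pos).2.symm

lemma Matrix.PosDef.log_det_le {A : Matrix n n ℂ} (hA : A.PosDef) :
    Real.log A.det.re ≤ (A - 1).trace.re := by
  have h1 : A.det.re = ∏ i, hA.1.eigenvalues i := by
    rw [hA.1.det_eq_prod_eigenvalues]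
    simp [← Complex.ofReal_prod]
  have h2 : (A - 1).trace.re = ∑ i, (hA.1.eigenvalues i - 1) := by
    rw [Matrix.trace_sub, hA.1.trace_eq_sum_eigenvalues]
    simp
  rw [h1, h2, Real.log_prod fun i _ => (hA.eigenvalues_pos i).ne']
  exact Finset.sum_le_sum fun i _ => Real.log_le_sub_one_of_pos (hA.eigenvalues_pos i)

/-- Concavity of `log det`, as a tangent inequality at `A`: factor `A⁻¹ = Cᴴ C` and apply
`log_det_le` to `C B Cᴴ`, whose determinant is `det B / det A`. -/
lemma Matrix.PosDef.log_det_sub_log_det_le {A B : Matrix n n ℂ} (hA : A.PosDef) (hB : B.PosDef) :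
    Real.log B.det.re - Real.log A.det.re ≤ (A⁻¹ * (B - A)).trace.re := by
  obtain ⟨C, hC⟩ := hA.inv.posSemidef.exists_eq_conjTranspose_mul_self
  have hu : IsUnit A.det := (Matrix.isUnit_iff_isUnit_det A).mp hA.isUnit
  have hdet : C.det * Cᴴ.det * A.det = 1 := by
    rw [mul_comm C.det, ← Matrix.det_mul, ← hC, ← Matrix.det_mul, Matrix.nonsing_inv_mul _ hu,
      Matrix.det_one]
  have hCu : IsUnit C := by
    rw [Matrix.isUnit_iff_isUnit_det, isUnit_iff_ne_zero]
    intro h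
    simp [h] at hdet
  have hD : (C * B * Cᴴ).PosDef :=
    hB.mul_mul_conjTranspose_same (Matrix.vecMul_injective_iff_isUnit.mpr hCu)
  have h1 : (C * B * Cᴴ).det * A.det = B.det := by
    rw [Matrix.det_mul, Matrix.det_mul]
    linear_combination B.det * hdet
  have h2 : (C * B * Cᴴ).det.re * A.det.re = B.det.re := by
    rw [hD.det_eq_re, hA.det_eq_re, ← Complex.ofReal_mul] at h1
    exact congrArg Complex.re h1
  rw [← h2, Real.log_mul hD.det_re_pos.ne' hA.det_re_pos.ne', add_sub_cancel_right]
  refine hD.log_det_le.trans_eq ?_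
  rw [Matrix.mul_sub, Matrix.nonsing_inv_mul _ hu, hC, Matrix.trace_sub, Matrix.trace_sub,
    Matrix.mul_assoc Cᴴ, Matrix.trace_mul_comm Cᴴ]

/-- Resolvent identity; it exhibits the trace below as that of a product of two positive
semidefinite matrices. -/
lemma Matrix.PosDef.inv_sub_inv_mul_sub {A B : Matrix n n ℂ} (hA : A.PosDef) (hB : B.PosDef) :
    (A⁻¹ - B⁻¹) * (B - A) = A⁻¹ * ((B - A) * B⁻¹ * (B - A)) := by
  have hu : IsUnit A.det := (Matrix.isUnit_iff_isUnit_det A).mp hA.isUnit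
  have hv : IsUnit B.det := (Matrix.isUnit_iff_isUnit_det B).mp hB.isUnit
  rw [← Matrix.mul_assoc, ← Matrix.mul_assoc]
  congr 1
  rw [Matrix.mul_sub, Matrix.nonsing_inv_mul _ hu, Matrix.sub_mul, Matrix.one_mul,
    Matrix.mul_assoc, Matrix.mul_nonsing_inv _ hv, Matrix.mul_one]

lemma Matrix.PosDef.trace_inv_sub_inv_mul_sub_nonneg {A B : Matrix n n ℂ} (hA : A.PosDef)
    (hB : B.PosDef) : 0 ≤ ((A⁻¹ - B⁻¹) * (B - A)).trace.re := by
  rw [hA.inv_sub_inv_mul_sub hB]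
  refine hA.inv.posSemidef.trace_mul_re_nonneg ?_
  have := hB.inv.posSemidef.mul_mul_conjTranspose_same (B - A)
  rwa [(hB.1.sub hA.1).eq] at this

/-- For `A = Cᴴ C` the trace is the squared Frobenius norm of `C X`, and `C` is invertible. -/
lemma Matrix.PosDef.eq_zero_of_trace_mul {A : Matrix n n ℂ} (hA : A.PosDef) {X : Matrix n m ℂ}
    (h : (A * (X * Xᴴ)).trace.re = 0) : X = 0 := by
  obtain ⟨C, rfl⟩ := hA.posSemidef.exists_eq_conjTranspose_mul_self
  have hCu : IsUnit C.det := by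
    rw [isUnit_iff_ne_zero]
    intro h0
    have := hA.det_pos
    simp [h0] at this
  rw [Matrix.mul_assoc, Matrix.trace_mul_comm, Matrix.mul_assoc, Matrix.mul_assoc,
    ← Matrix.mul_assoc C, ← Matrix.conjTranspose_mul] at h
  have h1 := (Matrix.posSemidef_self_mul_conjTranspose (C * X)).trace_eq_zero_of_re h
  rw [Matrix.self_mul_conjTranspose_eq_zero] at h1
  rw [← Matrix.nonsing_inv_mul_cancel_left C X hCu, h1, Matrix.mul_zero]

lemma Matrix.PosDef.eq_of_trace_inv_sub_inv_mul_sub {A B : Matrix n n ℂ} (hA : A.PosDef)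
    (hB : B.PosDef) (h : ((A⁻¹ - B⁻¹) * (B - A)).trace.re = 0) : A = B := by
  rw [hA.inv_sub_inv_mul_sub hB] at h
  obtain ⟨C, hC⟩ := hB.inv.posSemidef.exists_eq_conjTranspose_mul_self
  have hv : IsUnit B.det := (Matrix.isUnit_iff_isUnit_det B).mp hB.isUnit
  have hCu : IsUnit C.det := by
    rw [isUnit_iff_ne_zero]
    intro h0
    have := hB.inv.det_pos
    rw [hC] at this
    simp [h0] at this
  have h1 : (B - A) * B⁻¹ * (B - A) = ((B - A) * Cᴴ) * ((B - A) * Cᴴ)ᴴ := by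
    rw [Matrix.conjTranspose_mul, (hB.1.sub hA.1).eq, Matrix.conjTranspose_conjTranspose, hC]
    simp only [Matrix.mul_assoc]
  rw [h1] at h
  have h2 := hA.inv.eq_zero_of_trace_mul h
  have hCu' : IsUnit Cᴴ.det := by rw [Matrix.det_conjTranspose]; exact hCu.star
  have h3 : B - A = 0 := by
    rw [← Matrix.mul_nonsing_inv_cancel_right Cᴴ (B - A) hCu', h2, Matrix.zero_mul]
  exact (sub_eq_zero.mp h3).symm

/-- Writing `A = Bᴴ B`, the inequality `ab ≤ (a² + b²) / 2` bounds the entry by the mean of two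
diagonal entries. -/
lemma Matrix.PosSemidef.norm_apply_le_trace {A : Matrix n n ℂ} (hA : A.PosSemidef) (i j : n) :
    ‖A i j‖ ≤ A.trace.re := by
  obtain ⟨B, rfl⟩ := hA.exists_eq_conjTranspose_mul_self
  have hd : ∀ j, ((Bᴴ * B) j j).re = ∑ k, ‖B k j‖ ^ 2 := by
    intro j
    simp only [Matrix.mul_apply, Matrix.conjTranspose_apply, Complex.re_sum]
    refine Finset.sum_congr rfl fun k _ => ?_
    rw [RCLike.star_def, ← Complex.normSq_eq_conj_mul_self, Complex.ofReal_re,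
      Complex.normSq_eq_norm_sq]
  have hle : ∀ j, ∑ k, ‖B k j‖ ^ 2 ≤ (Bᴴ * B).trace.re := by
    intro j
    simp only [Matrix.trace, Matrix.diag_apply, Complex.re_sum, hd]
    exact Finset.single_le_sum (f := fun j => ∑ k, ‖B k j‖ ^ 2)
      (fun i _ => by positivity) (Finset.mem_univ j)
  have h1 : ‖(Bᴴ * B) i j‖ ≤ ∑ k, (‖B k i‖ ^ 2 + ‖B k j‖ ^ 2) / 2 := by
    rw [Matrix.mul_apply]
    refine norm_sum_le_of_le _ fun k _ => ?_
    rw [Matrix.conjTranspose_apply, norm_mul, norm_star]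
    nlinarith [sq_nonneg (‖B k i‖ - ‖B k j‖)]
  rw [← Finset.sum_div, Finset.sum_add_distrib] at h1
  linarith [hle i, hle j]

lemma Matrix.PosSemidef.apply_eq_zero {A : Matrix n n ℂ} (hA : A.PosSemidef) {j : n}
    (h : (A j j).re = 0) (i : n) : A i j = 0 ∧ A j i = 0 := by
  have hd : A j j = 0 :=
    Complex.ext h (Complex.le_def.mp hA.diag_nonneg).2.symm
  obtain ⟨B, hB⟩ := hA.exists_eq_conjTranspose_mul_self
  have hz : B *ᵥ Pi.single j 1 = 0 := by
    rw [← dotProduct_star_self_eq_zero]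
    rw [hB] at hd
    simpa [dotProduct, Matrix.mul_apply, mul_comm] using hd
  have hz' : ∀ k, B k j = 0 := fun k => by simpa using congrFun hz k
  simp [hB, Matrix.mul_apply, hz']

end MatrixLemmas

/-! ### The complex Gaussian law and the support of the fading. -/

section ComplexGaussian

lemma measurable_ofReal_add_ofReal_mul_I :
    Measurable (fun p : ℝ × ℝ => (p.1 : ℂ) + (p.2 : ℂ) * Complex.I) := by
  fun_prop

instance (v : ℝ≥0) : IsProbabilityMeasure (complexGaussian v) :=
  Measure.isProbabilityMeasure_map measurable_ofReal_add_ofReal_mul_I.aemeasurable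

lemma complexGaussian_zero : complexGaussian 0 = Measure.dirac 0 := by
  rw [complexGaussian, zero_div, gaussianReal_zero_var, Measure.dirac_prod_dirac,
    Measure.map_dirac' measurable_ofReal_add_ofReal_mul_I]
  simp

lemma isOpenPosMeasure_complexGaussian {v : ℝ≥0} (hv : v ≠ 0) :
    (complexGaussian v).IsOpenPosMeasure := by
  have : (gaussianReal 0 (v / 2)).IsOpenPosMeasure :=
    (gaussianReal_absolutelyContinuous' 0 (by positivity)).isOpenPosMeasure
  refine Continuous.isOpenPosMeasure_map (by fun_prop) fun z => ⟨(z.re, z.im), ?_⟩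
  exact Complex.re_add_im z

lemma memLp_id_complexGaussian (v : ℝ≥0) : MemLp id 2 (complexGaussian v) := by
  have h := memLp_id_gaussianReal' (μ := 0) (v := v / 2) 2 (by simp)
  rw [complexGaussian, memLp_map_measure_iff aestronglyMeasurable_id
    measurable_ofReal_add_ofReal_mul_I.aemeasurable]
  have h1 : MemLp (fun p : ℝ × ℝ => (p.1 : ℂ))  2
      ((gaussianReal 0 (v / 2)).prod (gaussianReal 0 (v / 2))) :=
    (h.comp_measurePreserving measurePreserving_fst).ofReal
  have h2 : MemLp (fun p : ℝ × ℝ => (p.2 : ℂ))  2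
      ((gaussianReal 0 (v / 2)).prod (gaussianReal 0 (v / 2))) :=
    (h.comp_measurePreserving measurePreserving_snd).ofReal
  exact h1.add (h2.mul_const Complex.I)

end ComplexGaussian

namespace IsGaussianFading

variable {K nr nt : ℕ} {Ω : Type*} [MeasurableSpace Ω] {P : Measure Ω}
  {σ : Fin K → Fin nr → Fin nt → ℝ≥0} {Htilde : Fin K → Ω → Matrix (Fin nr) (Fin nt) ℂ}

lemma memLp (hH : IsGaussianFading P σ Htilde) (k i j) :
    MemLp (fun ω => Htilde k ω i j) 2 P := by
  have h := memLp_id_complexGaussian (σ k i j / (nt : ℝ≥0))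
  rw [← (hH.law k i j).map_eq,
    memLp_map_measure_iff aestronglyMeasurable_id (hH.law k i j).aemeasurable] at h
  exact h

lemma ae_eq_zero (hH : IsGaussianFading P σ Htilde) {k i j} (h : σ k i j = 0) :
    ∀ᵐ ω ∂P, Htilde k ω i j = 0 := by
  have hl := hH.law k i j
  rw [h, zero_div, complexGaussian_zero] at hl
  have h0 : ∀ᵐ z ∂(P.map fun ω => Htilde k ω i j), z = 0 := by
    rw [hl.map_eq, ae_dirac_eq]
    simp
  exact ae_of_ae_map hl.aemeasurable h0

/-- The law of the fading matrices charges every open set which meets the subspace cut out by the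
variance profile. -/
lemma eq_zero_of_ae_eq_zero {E : Type*} [TopologicalSpace E] [T1Space E] [Zero E]
    (hH : IsGaussianFading P σ Htilde)
    {F : (Fin K → Matrix (Fin nr) (Fin nt) ℂ) → E} (hF : Continuous F)
    (h : ∀ᵐ ω ∂P, F (fun k => Htilde k ω) = 0) {H₀ : Fin K → Matrix (Fin nr) (Fin nt) ℂ}
    (hH₀ : ∀ k i j, σ k i j = 0 → H₀ k i j = 0) : F H₀ = 0 := by
  by_contra hne
  let e : (Fin K × Fin nr × Fin nt → ℂ) → (Fin K → Matrix (Fin nr) (Fin nt) ℂ) :=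
    fun x k => Matrix.of fun i j => x (k, i, j)
  have he : Continuous e :=
    continuous_pi fun k => continuous_matrix fun i j => continuous_apply (k, i, j)
  -- An open box around `H₀` on which `F` is nonzero. By independence its probability is a product;
  -- a factor with zero variance is a Dirac mass at `0 = H₀ k i j`, the others have full support.
  obtain ⟨u, hu, hsub⟩ := isOpen_pi_iff'.mp
    ((isClosed_singleton (x := (0 : E))).isOpen_compl.preimage (hF.comp he))
    (fun x => H₀ x.1 x.2.1 x.2.2) hne
  have hpos : P (⋂ x ∈ (Finset.univ : Finset (Fin K × Fin nr × Fin nt)),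
      (fun ω => Htilde x.1 ω x.2.1 x.2.2) ⁻¹' u x) ≠ 0 := by
    rw [hH.indep.measure_inter_preimage_eq_mul Finset.univ fun x _ => (hu x).1.measurableSet]
    refine Finset.prod_ne_zero_iff.mpr fun x _ => ?_
    have hl := hH.law x.1 x.2.1 x.2.2
    rw [← Measure.map_apply_of_aemeasurable hl.aemeasurable (hu x).1.measurableSet, hl.map_eq]
    by_cases hσ : σ x.1 x.2.1 x.2.2 = 0
    · have hx := (hu x).2
      simp only [hH₀ _ _ _ hσ] at hx
      rw [hσ, zero_div, complexGaussian_zero, Measure.dirac_apply' _ (hu x).1.measurableSet]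
      simp [hx]
    · have hnt : (nt : ℝ≥0) ≠ 0 := by
        have := x.2.2.pos
        positivity
      have := isOpenPosMeasure_complexGaussian (div_ne_zero hσ hnt)
      exact (hu x).1.measure_ne_zero _ ⟨_, (hu x).2⟩
  refine hpos (measure_mono_null ?_ h)
  intro ω hω
  simp only [Finset.mem_univ, Set.iInter_true, Set.mem_iInter, Set.mem_preimage] at hω
  exact hsub (show (fun x : Fin K × Fin nr × Fin nt => Htilde x.1 ω x.2.1 x.2.2) ∈ Set.univ.pi u
    from fun x _ => hω x)

end IsGaussianFading

/-! ### Integrability and measurability of functions of the channels. -/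

section SquareIntegrable

variable {Ω : Type*} [MeasurableSpace Ω] {P : Measure Ω} {l m n q : Type*}
  [Fintype m] [Fintype n]

lemma memLp_matrix_mul_mul {H : Ω → Matrix m n ℂ} (hH : ∀ i j, MemLp (fun ω => H ω i j) 2 P)
    (A : Matrix l m ℂ) (B : Matrix n q ℂ) (i : l) (j : q) :
    MemLp (fun ω => (A * H ω * B) i j) 2 P := by
  simp only [Matrix.mul_apply]
  exact memLp_finsetSum _ fun b _ =>
    (memLp_finsetSum _ fun a _ => (hH a b).const_mul (A i a)).mul_const (B b j)

lemma aestronglyMeasurable_continuous_comp {ι E : Type*} [Fintype ι] [TopologicalSpace E]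
    [TopologicalSpace.PseudoMetrizableSpace E]
    {H : ι → Ω → Matrix m n ℂ} (hH : ∀ k i j, AEStronglyMeasurable (fun ω => H k ω i j) P)
    {F : (ι → Matrix m n ℂ) → E} (hF : Continuous F) :
    AEStronglyMeasurable (fun ω => F fun k => H k ω) P := by
  let e : (ι × m × n → ℂ) → (ι → Matrix m n ℂ) := fun x k => Matrix.of fun i j => x (k, i, j)
  have he : Continuous e :=
    continuous_pi fun k => continuous_matrix fun i j => continuous_apply (k, i, j)
  have h : AEMeasurable (fun ω (x : ι × m × n) => H x.1 ω x.2.1 x.2.2) P :=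
    aemeasurable_pi_iff.mpr fun x => (hH x.1 x.2.1 x.2.2).aemeasurable
  exact (hF.comp he).comp_aestronglyMeasurable h.aestronglyMeasurable

end SquareIntegrable

/-- The normalized covariance `I + ρ ∑ H_l Q_l H_lᴴ` of the received signal. -/
def receivedCovariance {K nr nt : ℕ} (ρ : ℝ) (H : Fin K → Matrix (Fin nr) (Fin nt) ℂ)
    (Q : Fin K → Matrix (Fin nt) (Fin nt) ℂ) : Matrix (Fin nr) (Fin nr) ℂ :=
  1 + (ρ : ℂ) • ∑ l, H l * Q l * (H l)ᴴ

/-- The ergodic sum rate, which is a potential of the single-user-decoding game. -/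
noncomputable def sumRate {K nr nt : ℕ} {Ω : Type*} [MeasurableSpace Ω] (P : Measure Ω) (ρ : ℝ)
    (H : Fin K → Ω → Matrix (Fin nr) (Fin nt) ℂ)
    (Q : Fin K → Matrix (Fin nt) (Fin nt) ℂ) : ℝ :=
  ∫ ω, logDet (receivedCovariance ρ (fun l => H l ω) Q) ∂P

/-! ### Received covariances for a fixed channel realization. -/

section Deterministic

variable {K nr nt : ℕ} {ρ : ℝ} {H : Fin K → Matrix (Fin nr) (Fin nt) ℂ}
  {Q Q' : Fin K → Matrix (Fin nt) (Fin nt) ℂ}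

lemma sudInterference_add_self (k : Fin K) :
    sudInterference ρ H Q k + (ρ : ℂ) • (H k * Q k * (H k)ᴴ) = receivedCovariance ρ H Q := by
  rw [sudInterference, receivedCovariance, add_assoc, ← smul_add,
    Finset.sum_erase_add _ _ (Finset.mem_univ k)]

lemma receivedCovariance_update (k : Fin K) (b : Matrix (Fin nt) (Fin nt) ℂ) :
    receivedCovariance ρ H (Function.update Q k b) =
      sudInterference ρ H Q k + (ρ : ℂ) • (H k * b * (H k)ᴴ) := by
  rw [← sudInterference_add_self k, Function.update_self]
  congr 1
  rw [sudInterference, sudInterference]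
  congr 2
  refine Finset.sum_congr rfl fun l hl => ?_
  rw [Function.update_of_ne (Finset.ne_of_mem_erase hl)]

lemma receivedCovariance_update_zero (k : Fin K) :
    receivedCovariance ρ H (Function.update Q k 0) = sudInterference ρ H Q k := by
  simp [receivedCovariance_update]

lemma receivedCovariance_update_sub (k : Fin K) (b : Matrix (Fin nt) (Fin nt) ℂ) :
    receivedCovariance ρ H (Function.update Q k b) - receivedCovariance ρ H Q =
      (ρ : ℂ) • (H k * (b - Q k) * (H k)ᴴ) := by
  rw [receivedCovariance_update, ← sudInterference_add_self k, add_sub_add_left_eq_sub, ← smul_sub,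
    Matrix.mul_sub, Matrix.sub_mul]

lemma receivedCovariance_sub :
    receivedCovariance ρ H Q' - receivedCovariance ρ H Q =
      (ρ : ℂ) • ∑ l, H l * (Q' l - Q l) * (H l)ᴴ := by
  rw [receivedCovariance, receivedCovariance, add_sub_add_left_eq_sub, ← smul_sub,
    ← Finset.sum_sub_distrib]
  simp only [Matrix.mul_sub, Matrix.sub_mul]

lemma posSemidef_receivedCovariance_sub_one (hρ : 0 ≤ ρ) (hQ : ∀ l, (Q l).PosSemidef) :
    (receivedCovariance ρ H Q - 1).PosSemidef := by
  rw [receivedCovariance, add_sub_cancel_left]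
  exact (Matrix.posSemidef_sum _ fun l _ => (hQ l).mul_mul_conjTranspose_same (H l)).smul
    (Complex.zero_le_real.mpr hρ)

lemma posDef_receivedCovariance (hρ : 0 ≤ ρ) (hQ : ∀ l, (Q l).PosSemidef) :
    (receivedCovariance ρ H Q).PosDef := by
  have := Matrix.PosDef.one.add_posSemidef
    (posSemidef_receivedCovariance_sub_one (H := H) hρ hQ)
  rwa [add_sub_cancel] at this

lemma logDet_mul_log_two {M : Matrix (Fin nr) (Fin nr) ℂ} :
    logDet M * Real.log 2 = Real.log M.det.re :=
  div_mul_cancel₀ _ (Real.log_pos one_lt_two).ne'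

/-- The tangent inequality at `M`, evaluated at `1`, reads `-log det M ≤ -tr (1 - M⁻¹) ≤ 0`. -/
lemma logDet_nonneg {M : Matrix (Fin nr) (Fin nr) ℂ} (hM : M.PosDef) (h : (M - 1).PosSemidef) :
    0 ≤ logDet M := by
  have h1 := hM.log_det_sub_log_det_le (Matrix.PosDef.one (R := ℂ))
  have hu : IsUnit M.det := (Matrix.isUnit_iff_isUnit_det M).mp hM.isUnit
  have h2 := (hM.posSemidef_one_sub_inv h).trace_re_nonneg
  rw [Matrix.mul_sub, Matrix.mul_one, Matrix.nonsing_inv_mul _ hu, ← neg_sub 1 M⁻¹, Matrix.trace_neg,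
    Complex.neg_re, Matrix.det_one, Complex.one_re, Real.log_one, ← logDet_mul_log_two] at h1
  have := Real.log_pos one_lt_two
  by_contra hneg
  nlinarith

lemma abs_logDet_le {M : Matrix (Fin nr) (Fin nr) ℂ} (hM : M.PosDef) (h : (M - 1).PosSemidef) :
    |logDet M| ≤ (M - 1).trace.re / Real.log 2 := by
  rw [abs_of_nonneg (logDet_nonneg hM h), le_div_iff₀ (Real.log_pos one_lt_two),
    logDet_mul_log_two]
  exact hM.log_det_le

/-- A bound for the received power per unit of transmitted power. -/
noncomputable def gainBound (G : Matrix (Fin nr) (Fin nt) ℂ) : ℝ :=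
  ∑ a, ∑ i, ∑ j, ‖G a i‖ * ‖G a j‖

lemma gainBound_nonneg (G : Matrix (Fin nr) (Fin nt) ℂ) : 0 ≤ gainBound G := by
  unfold gainBound
  positivity

/-- Separates the transmitted power from the channel, so that one integrable function dominates all
feasible inputs. -/
lemma trace_mul_mul_conjTranspose_re_le (G : Matrix (Fin nr) (Fin nt) ℂ)
    {B : Matrix (Fin nt) (Fin nt) ℂ} (hB : B.PosSemidef) :
    (G * B * Gᴴ).trace.re ≤ B.trace.re * gainBound G := by
  refine (Complex.re_le_norm _).trans ?_
  rw [Matrix.trace, gainBound, Finset.mul_sum]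
  refine norm_sum_le_of_le _ fun a _ => ?_
  rw [Matrix.diag_apply, Matrix.mul_apply, Finset.sum_comm, Finset.mul_sum]
  refine norm_sum_le_of_le _ fun j _ => ?_
  rw [Matrix.mul_apply, Finset.sum_mul, Finset.mul_sum]
  refine norm_sum_le_of_le _ fun i _ => ?_
  rw [Matrix.conjTranspose_apply, norm_mul, norm_mul, norm_star]
  calc ‖G a i‖ * ‖B i j‖ * ‖G a j‖ = ‖B i j‖ * (‖G a i‖ * ‖G a j‖) := by ring
    _ ≤ _ := by gcongr; exact hB.norm_apply_le_trace i j

lemma abs_logDet_receivedCovariance_le (hρ : 0 ≤ ρ) (hQ : ∀ l, (Q l).PosSemidef) {p : Fin K → ℝ}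
    (hp : ∀ l, (Q l).trace.re ≤ p l) :
    |logDet (receivedCovariance ρ H Q)| ≤ ρ * (∑ l, p l * gainBound (H l)) / Real.log 2 := by
  refine (abs_logDet_le (posDef_receivedCovariance hρ hQ)
    (posSemidef_receivedCovariance_sub_one hρ hQ)).trans ?_
  have := Real.log_pos one_lt_two
  gcongr
  rw [receivedCovariance, add_sub_cancel_left, Matrix.trace_smul, smul_eq_mul,
    Complex.re_ofReal_mul, Matrix.trace_sum, Complex.re_sum]
  gcongr with l _
  exact (trace_mul_mul_conjTranspose_re_le _ (hQ l)).trans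
    (mul_le_mul_of_nonneg_right (hp l) (gainBound_nonneg _))

lemma continuousAt_inv_of_posDef {M : Matrix (Fin nr) (Fin nr) ℂ} (hM : M.PosDef) :
    ContinuousAt Inv.inv M := by
  refine continuousAt_matrix_inv M ?_
  rw [Ring.inverse_eq_inv']
  exact continuousAt_inv₀ hM.det_pos.ne'

lemma continuousAt_logDet_of_posDef {M : Matrix (Fin nr) (Fin nr) ℂ} (hM : M.PosDef) :
    ContinuousAt logDet M := by
  unfold logDet Real.logb
  have hc : ContinuousAt (fun M : Matrix (Fin nr) (Fin nr) ℂ => M.det.re) M :=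
    (Complex.continuous_re.comp continuous_id.matrix_det).continuousAt
  exact (hc.log hM.det_re_pos.ne').div_const _

lemma continuous_receivedCovariance :
    Continuous fun x : (Fin K → Matrix (Fin nr) (Fin nt) ℂ) × (Fin K → Matrix (Fin nt) (Fin nt) ℂ)
      => receivedCovariance ρ x.1 x.2 := by
  unfold receivedCovariance
  fun_prop

end Deterministic

/-! ### Convexity and compactness of the action sets. -/

section ActionSets

variable {nt : ℕ} {p : ℝ}

lemma zero_mem_sudActions (hp : 0 ≤ p) : (0 : Matrix (Fin nt) (Fin nt) ℂ) ∈ sudActions nt p :=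
  ⟨Matrix.PosSemidef.zero, by simpa using mul_nonneg (Nat.cast_nonneg nt) hp⟩

lemma add_smul_sub_mem_sudActions {A B : Matrix (Fin nt) (Fin nt) ℂ} (hA : A ∈ sudActions nt p)
    (hB : B ∈ sudActions nt p) {t : ℝ} (h0 : 0 ≤ t) (h1 : t ≤ 1) :
    A + (t : ℂ) • (B - A) ∈ sudActions nt p := by
  have h : A + (t : ℂ) • (B - A) = ((1 - t : ℝ) : ℂ) • A + (t : ℂ) • B := by
    rw [smul_sub, Complex.ofReal_sub, sub_smul, Complex.ofReal_one, one_smul]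
    abel
  rw [h]
  refine ⟨(hA.1.smul (Complex.zero_le_real.mpr (by linarith))).add
    (hB.1.smul (Complex.zero_le_real.mpr h0)), ?_⟩
  rw [Matrix.trace_add, Matrix.trace_smul, Matrix.trace_smul, smul_eq_mul, smul_eq_mul,
    Complex.add_re, Complex.re_ofReal_mul, Complex.re_ofReal_mul]
  nlinarith [hA.2, hB.2]

lemma isClosed_setOf_posSemidef {n : Type*} [Fintype n] :
    IsClosed {A : Matrix n n ℂ | A.PosSemidef} := by
  simp only [Matrix.posSemidef_iff_dotProduct_mulVec, Set.ofPred_and, Set.ofPred_forall]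
  refine IsClosed.inter (isClosed_eq (by fun_prop) continuous_id) (isClosed_iInter fun x => ?_)
  have hc : Continuous fun A : Matrix n n ℂ => star x ⬝ᵥ A *ᵥ x := by fun_prop
  simp only [Complex.le_def, Set.ofPred_and]
  exact IsClosed.inter (isClosed_le continuous_const (Complex.continuous_re.comp hc))
    (isClosed_eq continuous_const (Complex.continuous_im.comp hc))

lemma isCompact_sudActions : IsCompact (sudActions nt p) := by
  have hb : IsCompact {A : Matrix (Fin nt) (Fin nt) ℂ |
      ∀ i, A i ∈ {r : Fin nt → ℂ | ∀ j, r j ∈ Metric.closedBall (0 : ℂ) (nt * p)}} :=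
    isCompact_pi_infinite fun _ => isCompact_pi_infinite fun _ => isCompact_closedBall _ _
  refine hb.of_isClosed_subset (isClosed_setOf_posSemidef.inter
    (isClosed_le (f := fun A : Matrix (Fin nt) (Fin nt) ℂ => A.trace.re) (by fun_prop)
      continuous_const)) fun A hA i j => ?_
  rw [mem_closedBall_zero_iff]
  exact (hA.1.norm_apply_le_trace i j).trans hA.2

end ActionSets

/-! ### Potential, existence, and first-order conditions. -/

section Game

variable {K nr nt : ℕ} {Ω : Type*} [MeasurableSpace Ω] {P : Measure Ω} {ρ : ℝ}
  {Pbar : Fin K → ℝ} {H : Fin K → Ω → Matrix (Fin nr) (Fin nt) ℂ}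
  {Q Q' : Fin K → Matrix (Fin nt) (Fin nt) ℂ}

lemma integrable_gainBound (hH : ∀ k i j, MemLp (fun ω => H k ω i j) 2 P) (k : Fin K) :
    Integrable (fun ω => gainBound (H k ω)) P := by
  unfold gainBound
  exact integrable_finsetSum _ fun a _ => integrable_finsetSum _ fun i _ =>
    integrable_finsetSum _ fun j _ => (hH k a i).norm.integrable_mul (hH k a j).norm

lemma aestronglyMeasurable_logDet_receivedCovariance
    (hH : ∀ k i j, MemLp (fun ω => H k ω i j) 2 P) (hρ : 0 ≤ ρ) (hQ : ∀ l, (Q l).PosSemidef) :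
    AEStronglyMeasurable (fun ω => logDet (receivedCovariance ρ (fun l => H l ω) Q)) P := by
  refine aestronglyMeasurable_continuous_comp (F := fun G => logDet (receivedCovariance ρ G Q))
    (fun k i j => (hH k i j).1) (continuous_iff_continuousAt.mpr fun G => ?_)
  exact ContinuousAt.comp (f := fun G => receivedCovariance ρ G Q)
    (continuousAt_logDet_of_posDef (posDef_receivedCovariance hρ hQ))
    (continuous_receivedCovariance.comp (Continuous.prodMk_left Q)).continuousAt

lemma integrable_bound_logDet (hH : ∀ k i j, MemLp (fun ω => H k ω i j) 2 P) (p : Fin K → ℝ) :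
    Integrable (fun ω => ρ * (∑ l, p l * gainBound (H l ω)) / Real.log 2) P :=
  ((integrable_finsetSum _ fun l _ => (integrable_gainBound hH l).const_mul (p l)).const_mul
    ρ).div_const _

lemma integrable_logDet_receivedCovariance
    (hH : ∀ k i j, MemLp (fun ω => H k ω i j) 2 P) (hρ : 0 ≤ ρ) (hQ : ∀ l, (Q l).PosSemidef) :
    Integrable (fun ω => logDet (receivedCovariance ρ (fun l => H l ω) Q)) P :=
  (integrable_bound_logDet hH fun l => (Q l).trace.re).mono'
    (aestronglyMeasurable_logDet_receivedCovariance hH hρ hQ)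
    (ae_of_all _ fun _ => abs_logDet_receivedCovariance_le hρ hQ fun _ => le_rfl)

lemma continuousOn_sumRate (hH : ∀ k i j, MemLp (fun ω => H k ω i j) 2 P) (hρ : 0 ≤ ρ) :
    ContinuousOn (sumRate P ρ H) (Set.univ.pi fun k => sudActions nt (Pbar k)) := by
  have : FirstCountableTopology (Matrix (Fin nt) (Fin nt) ℂ) :=
    inferInstanceAs (FirstCountableTopology (Fin nt → Fin nt → ℂ))
  refine continuousOn_of_dominated
    (bound := fun ω => ρ * (∑ l, (nt * Pbar l) * gainBound (H l ω)) / Real.log 2)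
    (fun Q hQ => aestronglyMeasurable_logDet_receivedCovariance hH hρ fun l => (hQ l trivial).1)
    (fun Q hQ => ae_of_all _ fun ω => abs_logDet_receivedCovariance_le hρ
      (fun l => (hQ l trivial).1) fun l => (hQ l trivial).2)
    (integrable_bound_logDet hH _) (ae_of_all _ fun ω Q hQ => ?_)
  exact (ContinuousAt.comp (f := fun Q => receivedCovariance ρ (fun l => H l ω) Q)
    (continuousAt_logDet_of_posDef (posDef_receivedCovariance hρ fun l => (hQ l trivial).1))
    (continuous_receivedCovariance.comp
      (Continuous.prodMk_right fun l => H l ω)).continuousAt).continuousWithinAt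

/-- The subtracted term is the sum rate with user `k` silent, hence unaffected by deviations of `k`.
-/
lemma sudUtility_eq (k : Fin K) :
    sudUtility P ρ H k Q = sumRate P ρ H Q - sumRate P ρ H (Function.update Q k 0) := by
  simp only [sudUtility, sumRate, sudTotalLogDet, sudInterferenceLogDet, sudInterference_add_self,
    receivedCovariance_update_zero]

lemma isNashEquilibrium_iff_sumRate :
    IsNashEquilibrium (fun k => sudActions nt (Pbar k)) (sudUtility P ρ H) Q ↔
      (∀ k, Q k ∈ sudActions nt (Pbar k)) ∧ ∀ k, ∀ b ∈ sudActions nt (Pbar k),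
        sumRate P ρ H (Function.update Q k b) ≤ sumRate P ρ H Q := by
  simp [IsNashEquilibrium, sudUtility_eq]

lemma exists_isNashEquilibrium (hH : ∀ k i j, MemLp (fun ω => H k ω i j) 2 P) (hρ : 0 ≤ ρ)
    (hPbar : ∀ k, 0 ≤ Pbar k) :
    ∃ Q, IsNashEquilibrium (fun k => sudActions nt (Pbar k)) (sudUtility P ρ H) Q := by
  obtain ⟨Q, hQ, hmax⟩ := (isCompact_univ_pi fun k =>
    isCompact_sudActions (nt := nt) (p := Pbar k)).exists_isMaxOn
    ⟨0, fun k _ => zero_mem_sudActions (hPbar k)⟩ (continuousOn_sumRate hH hρ)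
  refine ⟨Q, isNashEquilibrium_iff_sumRate.mpr ⟨fun k => hQ k trivial, fun k b hb => hmax ?_⟩⟩
  exact Set.update_mem_pi_iff_of_mem hQ |>.mpr fun _ => hb

lemma posSemidef_update {k : Fin K} {b : Matrix (Fin nt) (Fin nt) ℂ}
    (hQ : ∀ l, (Q l).PosSemidef) (hb : b.PosSemidef) (l : Fin K) :
    (Function.update Q k b l).PosSemidef := by
  by_cases h : l = k
  · subst h
    simpa using hb
  · simpa [h] using hQ l

lemma aestronglyMeasurable_trace_inv_mul (hH : ∀ k i j, MemLp (fun ω => H k ω i j) 2 P)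
    (hρ : 0 ≤ ρ) (hQ : ∀ l, (Q l).PosSemidef) (k : Fin K) (D : Matrix (Fin nt) (Fin nt) ℂ) :
    AEStronglyMeasurable (fun ω => ((receivedCovariance ρ (fun l => H l ω) Q)⁻¹ *
      (H k ω * D * (H k ω)ᴴ)).trace.re) P := by
  refine aestronglyMeasurable_continuous_comp
    (F := fun G => ((receivedCovariance ρ G Q)⁻¹ * (G k * D * (G k)ᴴ)).trace.re)
    (fun k i j => (hH k i j).1) ?_
  have h : Continuous fun G : Fin K → Matrix (Fin nr) (Fin nt) ℂ =>
      (receivedCovariance ρ G Q)⁻¹ := by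
    refine continuous_iff_continuousAt.mpr fun G => ?_
    exact ContinuousAt.comp (f := fun G => receivedCovariance ρ G Q)
      (continuousAt_inv_of_posDef (posDef_receivedCovariance hρ hQ))
      (continuous_receivedCovariance.comp (Continuous.prodMk_left Q)).continuousAt
  fun_prop

/-- Both parts are nonnegative and `M⁻¹ ≤ 1`; the bound is uniform in `M`, as dominated convergence
along a segment requires. -/
lemma abs_trace_inv_mul_le {M : Matrix (Fin nr) (Fin nr) ℂ} (hM : M.PosDef)
    (h : (M - 1).PosSemidef) (G : Matrix (Fin nr) (Fin nt) ℂ) {A B : Matrix (Fin nt) (Fin nt) ℂ}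
    (hA : A.PosSemidef) (hB : B.PosSemidef) :
    |(M⁻¹ * (G * (B - A) * Gᴴ)).trace.re| ≤ (B.trace.re + A.trace.re) * gainBound G := by
  rw [Matrix.mul_sub, Matrix.sub_mul, Matrix.mul_sub, Matrix.trace_sub, Complex.sub_re]
  have hA' := hA.mul_mul_conjTranspose_same G
  have hB' := hB.mul_mul_conjTranspose_same G
  have h1 := hM.inv.posSemidef.trace_mul_re_nonneg hA'
  have h2 := hM.inv.posSemidef.trace_mul_re_nonneg hB'
  have h3 := hM.trace_inv_mul_re_le h hA'
  have h4 := hM.trace_inv_mul_re_le h hB'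
  have h5 := trace_mul_mul_conjTranspose_re_le G hA
  have h6 := trace_mul_mul_conjTranspose_re_le G hB
  rw [abs_le]
  constructor <;> linarith

lemma integrable_trace_inv_mul (hH : ∀ k i j, MemLp (fun ω => H k ω i j) 2 P)
    (hρ : 0 ≤ ρ) (hQ : ∀ l, (Q l).PosSemidef) (k : Fin K) {A B : Matrix (Fin nt) (Fin nt) ℂ}
    (hA : A.PosSemidef) (hB : B.PosSemidef) :
    Integrable (fun ω => ((receivedCovariance ρ (fun l => H l ω) Q)⁻¹ *
      (H k ω * (B - A) * (H k ω)ᴴ)).trace.re) P :=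
  ((integrable_gainBound hH k).const_mul (B.trace.re + A.trace.re)).mono'
    (aestronglyMeasurable_trace_inv_mul hH hρ hQ k _)
    (ae_of_all _ fun _ => abs_trace_inv_mul_le (posDef_receivedCovariance hρ hQ)
      (posSemidef_receivedCovariance_sub_one hρ hQ) _ hA hB)

lemma tendsto_receivedCovariance_update (G : Fin K → Matrix (Fin nr) (Fin nt) ℂ)
    (Q : Fin K → Matrix (Fin nt) (Fin nt) ℂ) (k : Fin K) (b : Matrix (Fin nt) (Fin nt) ℂ) :
    Filter.Tendsto (fun t : ℝ => receivedCovariance ρ G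
      (Function.update Q k (Q k + (t : ℂ) • (b - Q k)))) (nhdsWithin 0 (Set.Ioi 0))
      (nhds (receivedCovariance ρ G Q)) := by
  have hc : Continuous fun t : ℝ => Q k + (t : ℂ) • (b - Q k) :=
    continuous_const.add (Complex.continuous_ofReal.smul continuous_const)
  have hcont : Continuous fun t : ℝ => receivedCovariance ρ G
      (Function.update Q k (Q k + (t : ℂ) • (b - Q k))) := by
    simp only [receivedCovariance_update]
    fun_prop
  have h0 := hcont.tendsto 0
  simp only [Complex.ofReal_zero, zero_smul, add_zero, Function.update_eq_self] at h0
  exact h0.mono_left nhdsWithin_le_nhds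

/-- The first-order optimality condition satisfied by a Nash equilibrium. -/
lemma IsNashEquilibrium.integral_trace_inv_mul_nonpos
    (hH : ∀ k i j, MemLp (fun ω => H k ω i j) 2 P) (hρ : 0 < ρ)
    (hQ : IsNashEquilibrium (fun k => sudActions nt (Pbar k)) (sudUtility P ρ H) Q) (k : Fin K)
    {b : Matrix (Fin nt) (Fin nt) ℂ} (hb : b ∈ sudActions nt (Pbar k)) :
    ∫ ω, ((receivedCovariance ρ (fun l => H l ω) Q)⁻¹ *
      (H k ω * (b - Q k) * (H k ω)ᴴ)).trace.re ∂P ≤ 0 := by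
  obtain ⟨hmem, hbest⟩ := isNashEquilibrium_iff_sumRate.mp hQ
  have hpsd : ∀ l, (Q l).PosSemidef := fun l => (hmem l).1
  let c : ℝ → Matrix (Fin nt) (Fin nt) ℂ := fun t => Q k + (t : ℂ) • (b - Q k)
  have hc : ∀ t ∈ Set.Ioc (0 : ℝ) 1, c t ∈ sudActions nt (Pbar k) := fun t ht =>
    add_smul_sub_mem_sudActions (hmem k) hb ht.1.le ht.2
  have hcQ : ∀ t ∈ Set.Ioc (0 : ℝ) 1, ∀ l, (Function.update Q k (c t) l).PosSemidef :=
    fun t ht => posSemidef_update hpsd (hc t ht).1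
  have hev : ∀ᶠ t in nhdsWithin (0 : ℝ) (Set.Ioi 0), t ∈ Set.Ioc (0 : ℝ) 1 :=
    Ioc_mem_nhdsGT one_pos
  have hlim : Filter.Tendsto (fun t => ∫ ω, ((receivedCovariance ρ (fun l => H l ω)
      (Function.update Q k (c t)))⁻¹ * (H k ω * (b - Q k) * (H k ω)ᴴ)).trace.re ∂P)
      (nhdsWithin 0 (Set.Ioi 0))
      (nhds (∫ ω, ((receivedCovariance ρ (fun l => H l ω) Q)⁻¹ *
        (H k ω * (b - Q k) * (H k ω)ᴴ)).trace.re ∂P)) := by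
    refine tendsto_integral_filter_of_dominated_convergence
      (fun ω => (b.trace.re + (Q k).trace.re) * gainBound (H k ω))
      (hev.mono fun t ht => aestronglyMeasurable_trace_inv_mul hH hρ.le (hcQ t ht) k _)
      (hev.mono fun t ht => ae_of_all _ fun ω =>
        abs_trace_inv_mul_le (posDef_receivedCovariance hρ.le (hcQ t ht))
          (posSemidef_receivedCovariance_sub_one hρ.le (hcQ t ht)) _ (hpsd k) hb.1)
      ((integrable_gainBound hH k).const_mul _) (ae_of_all _ fun ω => ?_)
    have hinv := (continuousAt_inv_of_posDef
      (posDef_receivedCovariance (H := fun l => H l ω) hρ.le hpsd)).tendsto.comp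
      (tendsto_receivedCovariance_update (fun l => H l ω) Q k b)
    have hF : Continuous fun A : Matrix (Fin nr) (Fin nr) ℂ =>
        (A * (H k ω * (b - Q k) * (H k ω)ᴴ)).trace.re := by fun_prop
    exact (hF.tendsto _).comp hinv
  refine le_of_tendsto hlim (hev.mono fun t ht => ?_)
  -- Taking the tangent at the perturbed point bounds its slope by the rate gain, which is
  -- nonpositive in mean at an equilibrium. Letting `t → 0` then replaces differentiation under the
  -- integral.
  have hpt : ∀ ω, t * ρ * ((receivedCovariance ρ (fun l => H l ω)
      (Function.update Q k (c t)))⁻¹ * (H k ω * (b - Q k) * (H k ω)ᴴ)).trace.re ≤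
      (logDet (receivedCovariance ρ (fun l => H l ω) (Function.update Q k (c t))) -
        logDet (receivedCovariance ρ (fun l => H l ω) Q)) * Real.log 2 := by
    intro ω
    have h1 := (posDef_receivedCovariance (H := fun l => H l ω) hρ.le
      (hcQ t ht)).log_det_sub_log_det_le
      (posDef_receivedCovariance (H := fun l => H l ω) hρ.le hpsd)
    rw [← neg_sub (receivedCovariance ρ (fun l => H l ω) (Function.update Q k (c t))),
      receivedCovariance_update_sub] at h1
    simp only [c, add_sub_cancel_left] at h1 ⊢
    rw [Matrix.mul_smul, Matrix.smul_mul, smul_smul, ← Complex.ofReal_mul, Matrix.mul_neg,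
      Matrix.mul_smul, Matrix.trace_neg, Matrix.trace_smul, smul_eq_mul, Complex.neg_re,
      Complex.re_ofReal_mul] at h1
    rw [sub_mul, logDet_mul_log_two, logDet_mul_log_two]
    linarith
  have hi1 := integrable_logDet_receivedCovariance hH hρ.le (hcQ t ht)
  have hi2 := integrable_logDet_receivedCovariance hH hρ.le hpsd
  have hint := integral_mono
    ((integrable_trace_inv_mul hH hρ.le (hcQ t ht) k (hpsd k) hb.1).const_mul (t * ρ))
    ((hi1.sub hi2).mul_const (Real.log 2)) hpt
  simp only [Pi.sub_apply] at hint
  rw [integral_const_mul, integral_mul_const, integral_sub hi1 hi2] at hint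
  have h2 := hbest k (c t) (hc t ht)
  rw [sumRate, sumRate] at h2
  have h3 : 0 < t * ρ := mul_pos ht.1 hρ
  have h4 := Real.log_pos one_lt_two
  by_contra! hneg
  nlinarith [mul_pos h3 hneg]

/-- Two Nash equilibria yield the same received covariance matrix. -/
lemma IsNashEquilibrium.ae_receivedCovariance_eq
    (hH : ∀ k i j, MemLp (fun ω => H k ω i j) 2 P) (hρ : 0 < ρ)
    (hQ : IsNashEquilibrium (fun k => sudActions nt (Pbar k)) (sudUtility P ρ H) Q)
    (hQ' : IsNashEquilibrium (fun k => sudActions nt (Pbar k)) (sudUtility P ρ H) Q') :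
    ∀ᵐ ω ∂P, receivedCovariance ρ (fun l => H l ω) Q =
      receivedCovariance ρ (fun l => H l ω) Q' := by
  have hpsd : ∀ l, (Q l).PosSemidef := fun l => (hQ.1 l).1
  have hpsd' : ∀ l, (Q' l).PosSemidef := fun l => (hQ'.1 l).1
  -- The covariance is affine in the profile, so the users' first-order conditions sum to one
  -- inequality for the full difference.
  have key : ∀ {A B : Fin K → Matrix (Fin nt) (Fin nt) ℂ},
      IsNashEquilibrium (fun k => sudActions nt (Pbar k)) (sudUtility P ρ H) A →
      IsNashEquilibrium (fun k => sudActions nt (Pbar k)) (sudUtility P ρ H) B →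
      Integrable (fun ω => ((receivedCovariance ρ (fun l => H l ω) A)⁻¹ *
        (receivedCovariance ρ (fun l => H l ω) B -
          receivedCovariance ρ (fun l => H l ω) A)).trace.re) P ∧
      ∫ ω, ((receivedCovariance ρ (fun l => H l ω) A)⁻¹ *
        (receivedCovariance ρ (fun l => H l ω) B -
          receivedCovariance ρ (fun l => H l ω) A)).trace.re ∂P ≤ 0 := by
    intro A B hA hB
    simp only [receivedCovariance_sub, Matrix.mul_smul, Matrix.trace_smul, smul_eq_mul,
      Complex.re_ofReal_mul, Matrix.mul_sum, Matrix.trace_sum, Complex.re_sum]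
    have hint := fun l => integrable_trace_inv_mul hH hρ.le (fun l => (hA.1 l).1) l
      (hA.1 l).1 (hB.1 l).1
    refine ⟨(integrable_finsetSum _ fun l _ => hint l).const_mul ρ, ?_⟩
    rw [integral_const_mul, integral_finsetSum _ fun l _ => hint l]
    exact mul_nonpos_of_nonneg_of_nonpos hρ.le
      (Finset.sum_nonpos fun l _ => hA.integral_trace_inv_mul_nonpos hH hρ l (hB.1 l))
  obtain ⟨hi1, h1⟩ := key hQ hQ'
  obtain ⟨hi2, h2⟩ := key hQ' hQ
  have hsum : ∀ ω, ((receivedCovariance ρ (fun l => H l ω) Q)⁻¹ *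
        (receivedCovariance ρ (fun l => H l ω) Q' -
          receivedCovariance ρ (fun l => H l ω) Q)).trace.re +
      ((receivedCovariance ρ (fun l => H l ω) Q')⁻¹ *
        (receivedCovariance ρ (fun l => H l ω) Q -
          receivedCovariance ρ (fun l => H l ω) Q')).trace.re =
      (((receivedCovariance ρ (fun l => H l ω) Q)⁻¹ -
        (receivedCovariance ρ (fun l => H l ω) Q')⁻¹) *
        (receivedCovariance ρ (fun l => H l ω) Q' -
          receivedCovariance ρ (fun l => H l ω) Q)).trace.re := by
    intro ω
    rw [← Complex.add_re, ← Matrix.trace_add, Matrix.sub_mul,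
      ← neg_sub (receivedCovariance ρ (fun l => H l ω) Q'), Matrix.mul_neg, ← sub_eq_add_neg]
  have hnn : ∀ ω, 0 ≤ (((receivedCovariance ρ (fun l => H l ω) Q)⁻¹ -
        (receivedCovariance ρ (fun l => H l ω) Q')⁻¹) *
        (receivedCovariance ρ (fun l => H l ω) Q' -
          receivedCovariance ρ (fun l => H l ω) Q)).trace.re := fun ω =>
    (posDef_receivedCovariance hρ.le hpsd).trace_inv_sub_inv_mul_sub_nonneg
      (posDef_receivedCovariance hρ.le hpsd')
  have hi := (hi1.add hi2).congr (ae_of_all _ hsum)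
  have h0 := integral_add hi1 hi2
  simp only [hsum] at h0
  have hz := (integral_eq_zero_iff_of_nonneg hnn hi).mp
    (le_antisymm (by linarith) (integral_nonneg hnn))
  filter_upwards [hz] with ω hω
  exact (posDef_receivedCovariance hρ.le hpsd).eq_of_trace_inv_sub_inv_mul_sub
    (posDef_receivedCovariance hρ.le hpsd') hω

end Game

/-! ### Recovering a matrix from its quadratic action on the profile. -/

section Profile

variable {nr nt : ℕ} {s : Fin nr → Fin nt → ℝ≥0} {E : Matrix (Fin nt) (Fin nt) ℂ}

lemma single_mul_mul_single_conjTranspose_apply (E : Matrix (Fin nt) (Fin nt) ℂ)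
    (i i' : Fin nr) (j j' : Fin nt) :
    (Matrix.single i j (1 : ℂ) * E * (Matrix.single i' j' (1 : ℂ))ᴴ) i i' = E j j' := by
  simp [Matrix.conjTranspose_single]

/-- Polarization with the matrix units at `(i, j)` and `(i', j')`, both supported on the profile. -/
lemma apply_eq_zero_of_forall_mul_mul_conjTranspose
    (h : ∀ G : Matrix (Fin nr) (Fin nt) ℂ, (∀ i j, s i j = 0 → G i j = 0) → G * E * Gᴴ = 0)
    {i i' : Fin nr} {j j' : Fin nt} (hj : s i j ≠ 0) (hj' : s i' j' ≠ 0) : E j j' = 0 := by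
  have hA : ∀ a b, s a b = 0 → (Matrix.single i j (1 : ℂ)) a b = 0 := by
    intro a b hab
    refine Matrix.single_apply_of_ne _ _ _ _ _ ?_
    rintro ⟨rfl, rfl⟩
    exact hj hab
  have hB : ∀ a b, s a b = 0 → (Matrix.single i' j' (1 : ℂ)) a b = 0 := by
    intro a b hab
    refine Matrix.single_apply_of_ne _ _ _ _ _ ?_
    rintro ⟨rfl, rfl⟩
    exact hj' hab
  rw [← single_mul_mul_single_conjTranspose_apply E i i' j j']
  generalize Matrix.single i j (1 : ℂ) = A at hA ⊢
  generalize Matrix.single i' j' (1 : ℂ) = B at hB ⊢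
  have hc : ∀ c : ℂ, star c • (A * E * Bᴴ) + c • (B * E * Aᴴ) = 0 := by
    intro c
    have h1 := h (A + c • B) fun a b hab => by simp [hA a b hab, hB a b hab]
    have h2 := h A hA
    have h3 := h B hB
    simp only [Matrix.conjTranspose_add, Matrix.conjTranspose_smul, Matrix.add_mul, Matrix.mul_add,
      Matrix.smul_mul, Matrix.mul_smul, h2, h3, smul_zero, zero_add, add_zero] at h1
    rwa [add_comm] at h1
  have h1 := hc 1
  have h2 := hc Complex.I
  -- The relation for `c = 1` plus `I` times that for `c = I` cancels `B E Aᴴ`.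
  have h3 : (2 : ℂ) • (A * E * Bᴴ) = 0 := by
    have : (2 : ℂ) • (A * E * Bᴴ) = (star (1 : ℂ) • (A * E * Bᴴ) + (1 : ℂ) • (B * E * Aᴴ)) +
        Complex.I • (star Complex.I • (A * E * Bᴴ) + Complex.I • (B * E * Aᴴ)) := by
      have h4 : Complex.I * star Complex.I = 1 := by simp
      rw [smul_add, smul_smul, smul_smul, h4, Complex.I_mul_I, star_one, neg_smul, two_smul]
      module
    rw [this, h1, h2, smul_zero, add_zero]
  rw [(smul_eq_zero.mp h3).resolve_left two_ne_zero, Matrix.zero_apply]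

lemma uiuChannel_mul_mul_conjTranspose {K : ℕ} {Ω : Type*}
    {V : Fin K → Matrix.unitaryGroup (Fin nr) ℂ} {W : Fin K → Matrix.unitaryGroup (Fin nt) ℂ}
    {Htilde : Fin K → Ω → Matrix (Fin nr) (Fin nt) ℂ} (k : Fin K) (ω : Ω)
    (D : Matrix (Fin nt) (Fin nt) ℂ) :
    uiuChannel V W Htilde k ω * D * (uiuChannel V W Htilde k ω)ᴴ =
      (V k : Matrix (Fin nr) (Fin nr) ℂ) * (Htilde k ω * ((W k : Matrix (Fin nt) (Fin nt) ℂ) * D *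
        (W k : Matrix (Fin nt) (Fin nt) ℂ)ᴴ) * (Htilde k ω)ᴴ) *
        (V k : Matrix (Fin nr) (Fin nr) ℂ)ᴴ := by
  simp only [uiuChannel, Matrix.conjTranspose_mul, Matrix.mul_assoc]

end Profile

/-! ### Uniqueness of the equilibrium. -/

section Uniqueness

variable {K nr nt : ℕ} {Ω : Type*} [MeasurableSpace Ω] {P : Measure Ω} {ρ : ℝ}
  {Pbar : Fin K → ℝ} {V : Fin K → Matrix.unitaryGroup (Fin nr) ℂ}
  {W : Fin K → Matrix.unitaryGroup (Fin nt) ℂ} {σ : Fin K → Fin nr → Fin nt → ℝ≥0}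
  {Htilde : Fin K → Ω → Matrix (Fin nr) (Fin nt) ℂ}
  {Q Q' : Fin K → Matrix (Fin nt) (Fin nt) ℂ}

lemma unitaryGroup_mul_mul_injective {m n : Type*} [Fintype m] [DecidableEq m] [Fintype n]
    [DecidableEq n] (U : Matrix.unitaryGroup m ℂ) (T : Matrix.unitaryGroup n ℂ)
    {X Y : Matrix m n ℂ} (h : (U : Matrix m m ℂ) * X * (T : Matrix n n ℂ) =
      (U : Matrix m m ℂ) * Y * (T : Matrix n n ℂ)) : X = Y := by
  have h1 : ((U : Matrix m m ℂ))ᴴ * U = 1 := Matrix.UnitaryGroup.star_mul_self U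
  have h2 : (T : Matrix n n ℂ) * (T : Matrix n n ℂ)ᴴ = 1 := Matrix.mem_unitaryGroup_iff.mp T.2
  have h3 : ∀ Z : Matrix m n ℂ, Z = (U : Matrix m m ℂ)ᴴ *
      ((U : Matrix m m ℂ) * Z * (T : Matrix n n ℂ)) * (T : Matrix n n ℂ)ᴴ := by
    intro Z
    rw [Matrix.mul_assoc (U : Matrix m m ℂ), ← Matrix.mul_assoc _ (U : Matrix m m ℂ), h1,
      Matrix.one_mul, Matrix.mul_assoc, h2, Matrix.mul_one]
  rw [h3 X, h, ← h3 Y]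

lemma IsGaussianFading.memLp_uiuChannel (hH : IsGaussianFading P σ Htilde) (k i j) :
    MemLp (fun ω => uiuChannel V W Htilde k ω i j) 2 P :=
  memLp_matrix_mul_mul (hH.memLp k) _ _ i j

/-- Equality of the received covariances identifies the input covariances on the active columns of
the variance profile. -/
lemma IsGaussianFading.conj_sub_apply_eq_zero (hH : IsGaussianFading P σ Htilde) (hρ : ρ ≠ 0)
    (h : ∀ᵐ ω ∂P, receivedCovariance ρ (fun l => uiuChannel V W Htilde l ω) Q =
      receivedCovariance ρ (fun l => uiuChannel V W Htilde l ω) Q')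
    {k : Fin K} {i i' : Fin nr} {j j' : Fin nt} (hj : σ k i j ≠ 0) (hj' : σ k i' j' ≠ 0) :
    ((W k : Matrix (Fin nt) (Fin nt) ℂ) * (Q k - Q' k) *
      (W k : Matrix (Fin nt) (Fin nt) ℂ)ᴴ) j j' = 0 := by
  refine apply_eq_zero_of_forall_mul_mul_conjTranspose (s := σ k) (fun G hG => ?_) hj hj'
  have hz := hH.eq_zero_of_ae_eq_zero (F := fun G : Fin K → Matrix (Fin nr) (Fin nt) ℂ =>
      ∑ l, (V l : Matrix (Fin nr) (Fin nr) ℂ) * (G l * ((W l : Matrix (Fin nt) (Fin nt) ℂ) *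
        (Q l - Q' l) * (W l : Matrix (Fin nt) (Fin nt) ℂ)ᴴ) * (G l)ᴴ) *
        (V l : Matrix (Fin nr) (Fin nr) ℂ)ᴴ) (by fun_prop) ?_
    -- Zero channels respect every profile, so the other users drop out whatever the matrices `V l`
    -- are.
    (H₀ := Pi.single k G) ?_
  · rw [Finset.sum_eq_single k (fun l _ hl => by simp [hl]) (by simp)] at hz
    rw [Pi.single_eq_same] at hz
    refine unitaryGroup_mul_mul_injective (V k) (star (V k)) ?_
    rw [Matrix.mul_zero, Matrix.zero_mul]
    exact hz
  · filter_upwards [h] with ω hω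
    have h1 := sub_eq_zero.mpr hω
    rw [receivedCovariance_sub] at h1
    simp only [uiuChannel_mul_mul_conjTranspose] at h1
    exact (smul_eq_zero.mp h1).resolve_left (Complex.ofReal_ne_zero.mpr hρ)
  · intro l a b hab
    by_cases hl : l = k
    · subst hl
      simpa using hG a b hab
    · simp [hl]

lemma Matrix.PosSemidef.diagonal_mul_mul_diagonal {n : Type*} [Fintype n]
    [DecidableEq n] {E : Matrix n n ℂ} (hE : E.PosSemidef) (d : n → ℝ) :
    (Matrix.diagonal (fun j => (d j : ℂ)) * E * Matrix.diagonal fun j => (d j : ℂ)).PosSemidef := by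
  have h := hE.mul_mul_conjTranspose_same (Matrix.diagonal fun j => (d j : ℂ))
  rw [Matrix.diagonal_conjTranspose] at h
  have hd : star (fun j => (d j : ℂ)) = fun j => (d j : ℂ) := by
    ext j
    simp
  rwa [hd] at h

/-- A Nash equilibrium does not waste power on the inactive columns of the variance profile. -/
lemma IsNashEquilibrium.conj_apply_self_re_eq_zero (hH : IsGaussianFading P σ Htilde) (hρ : 0 < ρ)
    (hσ : ∀ k, ∃ i j, σ k i j ≠ 0)
    (hQ : IsNashEquilibrium (fun k => sudActions nt (Pbar k))
      (sudUtility P ρ (uiuChannel V W Htilde)) Q) {k : Fin K} {j : Fin nt}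
    (hj : ∀ i, σ k i j = 0) :
    (((W k : Matrix (Fin nt) (Fin nt) ℂ) * Q k *
      (W k : Matrix (Fin nt) (Fin nt) ℂ)ᴴ) j j).re = 0 := by
  classical
  obtain ⟨i₀, j₀, h₀⟩ := hσ k
  have hWW : (W k : Matrix (Fin nt) (Fin nt) ℂ) * (W k : Matrix (Fin nt) (Fin nt) ℂ)ᴴ = 1 :=
    Matrix.mem_unitaryGroup_iff.mp (W k).2
  have hWW' : (W k : Matrix (Fin nt) (Fin nt) ℂ)ᴴ * (W k : Matrix (Fin nt) (Fin nt) ℂ) = 1 :=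
    Matrix.mem_unitaryGroup_iff'.mp (W k).2
  set E := (W k : Matrix (Fin nt) (Fin nt) ℂ) * Q k * (W k : Matrix (Fin nt) (Fin nt) ℂ)ᴴ with hE
  have hpsd : ∀ l, (Q l).PosSemidef := fun l => (hQ.1 l).1
  have hEpsd : E.PosSemidef := (hpsd k).mul_mul_conjTranspose_same _
  -- `D` projects onto the active columns and `δ` is the power spent outside them. The deviation
  -- `E'` truncates `E` by `D` and moves `δ` to the active column `j₀`, preserving the trace.
  let d : Fin nt → ℝ := fun j => if ∀ i, σ k i j = 0 then 0 else 1
  let D : Matrix (Fin nt) (Fin nt) ℂ := Matrix.diagonal fun j => (d j : ℂ)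
  let δ : ℝ := ∑ j, if ∀ i, σ k i j = 0 then (E j j).re else 0
  have hterm : ∀ j, 0 ≤ if ∀ i, σ k i j = 0 then (E j j).re else 0 := by
    intro j
    split_ifs
    · exact (Complex.le_def.mp hEpsd.diag_nonneg).1
    · exact le_rfl
  have hδ : 0 ≤ δ := Finset.sum_nonneg fun j _ => hterm j
  let S : Matrix (Fin nt) (Fin nt) ℂ := Matrix.single j₀ j₀ 1
  have hS : S * Sᴴ = S := by simp [S, Matrix.conjTranspose_single]
  have hSpsd : S.PosSemidef := by
    rw [← hS]
    exact Matrix.posSemidef_self_mul_conjTranspose S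
  let E' := D * E * D + (δ : ℂ) • S
  have hE'psd : E'.PosSemidef :=
    (hEpsd.diagonal_mul_mul_diagonal d).add
      (hSpsd.smul (Complex.zero_le_real.mpr hδ))
  have htr : E'.trace.re = E.trace.re := by
    have h1 : (D * E * D).trace.re = ∑ j, d j * (E j j).re := by
      simp only [Matrix.trace, Matrix.diag_apply, D, Matrix.mul_diagonal, Matrix.diagonal_mul,
        Complex.re_sum]
      refine Finset.sum_congr rfl fun j _ => ?_
      by_cases hj : ∀ i, σ k i j = 0 <;> simp [d, hj]
    have h2 : S.trace = 1 := Matrix.trace_single_eq_same _ _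
    rw [Matrix.trace_add, Matrix.trace_smul, h2, Complex.add_re, h1, smul_eq_mul, mul_one,
      Complex.ofReal_re, ← Finset.sum_add_distrib, Matrix.trace, Complex.re_sum]
    refine Finset.sum_congr rfl fun j _ => ?_
    by_cases hj : ∀ i, σ k i j = 0 <;> simp [d, hj]
  let b := (W k : Matrix (Fin nt) (Fin nt) ℂ)ᴴ * E' * (W k : Matrix (Fin nt) (Fin nt) ℂ)
  have hWbW : (W k : Matrix (Fin nt) (Fin nt) ℂ) * b * (W k : Matrix (Fin nt) (Fin nt) ℂ)ᴴ = E' := by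
    simp only [b, Matrix.mul_assoc, hWW, Matrix.mul_one]
    rw [← Matrix.mul_assoc, hWW, Matrix.one_mul]
  have hb : b ∈ sudActions nt (Pbar k) := by
    refine ⟨hE'psd.conjTranspose_mul_mul_same _, ?_⟩
    have h1 : b.trace = E'.trace := by
      rw [Matrix.trace_mul_comm, ← Matrix.mul_assoc, hWW, Matrix.one_mul]
    have h2 : E.trace = (Q k).trace := by
      rw [hE, Matrix.trace_mul_comm, ← Matrix.mul_assoc, hWW', Matrix.one_mul]
    rw [h1, htr, h2]
    exact (hQ.1 k).2
  -- Inactive columns of the fading vanish almost surely, so the truncation is invisible at the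
  -- receiver and only the moved power changes the covariance.
  have hD : ∀ᵐ ω ∂P, Htilde k ω * D = Htilde k ω := by
    have hae : ∀ᵐ ω ∂P, ∀ i j, σ k i j = 0 → Htilde k ω i j = 0 := by
      simp only [ae_all_iff]
      exact fun i j h => hH.ae_eq_zero h
    filter_upwards [hae] with ω hω
    ext i j
    rw [Matrix.mul_diagonal]
    by_cases hj : ∀ i, σ k i j = 0
    · simp [d, hj, hω i j (hj i)]
    · simp [d, hj]
  let Y : Ω → Matrix (Fin nr) (Fin nt) ℂ := fun ω =>
    (V k : Matrix (Fin nr) (Fin nr) ℂ) * Htilde k ω * S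
  have hdiff : ∀ᵐ ω ∂P, uiuChannel V W Htilde k ω * (b - Q k) * (uiuChannel V W Htilde k ω)ᴴ =
      (δ : ℂ) • (Y ω * (Y ω)ᴴ) := by
    filter_upwards [hD] with ω hω
    have hω' : D * (Htilde k ω)ᴴ = (Htilde k ω)ᴴ := by
      have hDh : Dᴴ = D := by
        rw [Matrix.diagonal_conjTranspose]
        congr 1
        ext j
        simp
      rw [← hDh, ← Matrix.conjTranspose_mul, hω]
    have hDED : Htilde k ω * (D * E * D) * (Htilde k ω)ᴴ = Htilde k ω * E * (Htilde k ω)ᴴ := by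
      rw [Matrix.mul_assoc, Matrix.mul_assoc (D * E), hω', ← Matrix.mul_assoc, ← Matrix.mul_assoc,
        hω]
    rw [uiuChannel_mul_mul_conjTranspose, Matrix.mul_sub, Matrix.sub_mul, hWbW, ← hE,
      Matrix.mul_sub, Matrix.sub_mul, Matrix.mul_add, Matrix.add_mul, hDED, add_sub_cancel_left,
      Matrix.mul_smul, Matrix.smul_mul, Matrix.mul_smul, Matrix.smul_mul]
    congr 1
    conv_lhs => rw [← hS]
    simp only [Y, Matrix.conjTranspose_mul, Matrix.mul_assoc]
  -- If `δ ≠ 0`, the first-order condition bounds the mean of a nonnegative function by zero,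
  -- forcing `Y = 0` almost surely; the matrix unit at the active position `(i₀, j₀)` contradicts
  -- this.
  have hδ0 : δ = 0 := by
    by_contra hne
    have hint := integrable_trace_inv_mul (ρ := ρ) (fun k i j =>
      hH.memLp_uiuChannel (V := V) (W := W) k i j) hρ.le hpsd k (hpsd k) hb.1
    have hle := hQ.integral_trace_inv_mul_nonpos
      (fun k i j => hH.memLp_uiuChannel k i j) hρ k hb
    have hpd : ∀ ω, (receivedCovariance ρ (fun l => uiuChannel V W Htilde l ω) Q).PosDef :=
      fun ω => posDef_receivedCovariance hρ.le hpsd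
    have heq : ∀ᵐ ω ∂P, ((receivedCovariance ρ (fun l => uiuChannel V W Htilde l ω) Q)⁻¹ *
        (uiuChannel V W Htilde k ω * (b - Q k) * (uiuChannel V W Htilde k ω)ᴴ)).trace.re =
        δ * ((receivedCovariance ρ (fun l => uiuChannel V W Htilde l ω) Q)⁻¹ *
          (Y ω * (Y ω)ᴴ)).trace.re := by
      filter_upwards [hdiff] with ω hω
      rw [hω, Matrix.mul_smul, Matrix.trace_smul, smul_eq_mul, Complex.re_ofReal_mul]
    have hnn : 0 ≤ᵐ[P] fun ω => ((receivedCovariance ρ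
        (fun l => uiuChannel V W Htilde l ω) Q)⁻¹ * (uiuChannel V W Htilde k ω * (b - Q k) *
          (uiuChannel V W Htilde k ω)ᴴ)).trace.re := by
      filter_upwards [heq] with ω hω
      rw [hω]
      exact mul_nonneg hδ ((hpd ω).inv.posSemidef.trace_mul_re_nonneg
        (Matrix.posSemidef_self_mul_conjTranspose _))
    have hz := (integral_eq_zero_iff_of_nonneg_ae hnn hint).mp
      (le_antisymm hle (integral_nonneg_of_ae hnn))
    have hY : ∀ᵐ ω ∂P, Y ω = 0 := by
      filter_upwards [hz, heq] with ω h1 h2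
      rw [h2] at h1
      exact (hpd ω).inv.eq_zero_of_trace_mul ((mul_eq_zero.mp h1).resolve_left hne)
    have h3 := hH.eq_zero_of_ae_eq_zero (F := fun G : Fin K → Matrix (Fin nr) (Fin nt) ℂ =>
      (V k : Matrix (Fin nr) (Fin nr) ℂ) * G k * S) (by fun_prop) hY
      (H₀ := Pi.single k (Matrix.single i₀ j₀ 1)) (by
        intro l a c hac
        by_cases hl : l = k
        · subst hl
          rw [Pi.single_eq_same]
          refine Matrix.single_apply_of_ne _ _ _ _ _ ?_
          rintro ⟨rfl, rfl⟩
          exact h₀ hac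
        · simp [hl])
    rw [Pi.single_eq_same, Matrix.mul_assoc] at h3
    have h4 : (Matrix.single i₀ j₀ (1 : ℂ) : Matrix (Fin nr) (Fin nt) ℂ) * S = 0 := by
      refine unitaryGroup_mul_mul_injective (V k) 1 ?_
      rw [h3, Matrix.mul_zero]
    have h5 := congrFun (congrFun h4 i₀) j₀
    simp [S] at h5
  have := (Finset.sum_eq_zero_iff_of_nonneg fun j _ => hterm j).mp hδ0 j (Finset.mem_univ j)
  rwa [if_pos hj] at this

lemma IsNashEquilibrium.eq_of_isGaussianFading (hH : IsGaussianFading P σ Htilde) (hρ : 0 < ρ)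
    (hσ : ∀ k, ∃ i j, σ k i j ≠ 0)
    (hQ : IsNashEquilibrium (fun k => sudActions nt (Pbar k))
      (sudUtility P ρ (uiuChannel V W Htilde)) Q)
    (hQ' : IsNashEquilibrium (fun k => sudActions nt (Pbar k))
      (sudUtility P ρ (uiuChannel V W Htilde)) Q') : Q = Q' := by
  have hcov := hQ.ae_receivedCovariance_eq (fun k i j => hH.memLp_uiuChannel k i j) hρ hQ'
  funext k
  refine unitaryGroup_mul_mul_injective (W k) (star (W k)) ?_
  change (W k : Matrix (Fin nt) (Fin nt) ℂ) * Q k * (W k : Matrix (Fin nt) (Fin nt) ℂ)ᴴ =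
    (W k : Matrix (Fin nt) (Fin nt) ℂ) * Q' k * (W k : Matrix (Fin nt) (Fin nt) ℂ)ᴴ
  have hpsd := (hQ.1 k).1.mul_mul_conjTranspose_same (W k : Matrix (Fin nt) (Fin nt) ℂ)
  have hpsd' := (hQ'.1 k).1.mul_mul_conjTranspose_same (W k : Matrix (Fin nt) (Fin nt) ℂ)
  ext j j'
  by_cases hj : ∀ i, σ k i j = 0
  · rw [(hpsd.apply_eq_zero (hQ.conj_apply_self_re_eq_zero hH hρ hσ hj) j').2,
      (hpsd'.apply_eq_zero (hQ'.conj_apply_self_re_eq_zero hH hρ hσ hj) j').2]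
  by_cases hj' : ∀ i, σ k i j' = 0
  · rw [(hpsd.apply_eq_zero (hQ.conj_apply_self_re_eq_zero hH hρ hσ hj') j).1,
      (hpsd'.apply_eq_zero (hQ'.conj_apply_self_re_eq_zero hH hρ hσ hj') j).1]
  obtain ⟨i, hi⟩ := not_forall.mp hj
  obtain ⟨i', hi'⟩ := not_forall.mp hj'
  have h := hH.conj_sub_apply_eq_zero hρ.ne' hcov hi hi'
  rw [Matrix.mul_sub, Matrix.sub_mul, Matrix.sub_apply] at h
  exact sub_eq_zero.mp h

end Uniqueness

theorem theorem6 {K nr nt : ℕ} (hK : 2 ≤ K)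
    {Ω : Type*} [MeasurableSpace Ω] (P : Measure Ω) [IsProbabilityMeasure P]
    (noiseVar : ℝ) (hnoise : 0 < noiseVar)
    (Pbar : Fin K → ℝ) (hPbar : ∀ k, 0 ≤ Pbar k)
    (V : Fin K → Matrix.unitaryGroup (Fin nr) ℂ)
    (W : Fin K → Matrix.unitaryGroup (Fin nt) ℂ)
    (σ : Fin K → Fin nr → Fin nt → ℝ≥0) (hσ : ∀ k, ∃ i j, 0 < σ k i j)
    (Htilde : Fin K → Ω → Matrix (Fin nr) (Fin nt) ℂ)
    (hH : IsGaussianFading P σ Htilde) :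
    (∀ Q : Fin K → Matrix (Fin nt) (Fin nt) ℂ, (∀ l, Q l ∈ sudActions nt (Pbar l)) →
      ∀ k, Integrable (sudTotalLogDet (1 / noiseVar) (uiuChannel V W Htilde) Q k) P ∧
        Integrable (sudInterferenceLogDet (1 / noiseVar) (uiuChannel V W Htilde) Q k) P) ∧
    ∃! Q : Fin K → Matrix (Fin nt) (Fin nt) ℂ,
      IsNashEquilibrium (fun k => sudActions nt (Pbar k))
        (sudUtility P (1 / noiseVar) (uiuChannel V W Htilde)) Q := by
  have hρ : 0 < 1 / noiseVar := one_div_pos.mpr hnoise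
  have hL : ∀ k i j, MemLp (fun ω => uiuChannel V W Htilde k ω i j) 2 P :=
    fun k i j => hH.memLp_uiuChannel k i j
  refine ⟨fun Q hQ k => ⟨?_, ?_⟩, ?_⟩
  · have h := integrable_logDet_receivedCovariance hL hρ.le fun l => (hQ l).1
    simp only [← sudInterference_add_self k] at h
    exact h
  -- The interference covariance is the received covariance with user `k` transmitting zero.
  · have h := integrable_logDet_receivedCovariance hL hρ.le
      (posSemidef_update (k := k) (fun l => (hQ l).1) Matrix.PosSemidef.zero)
    simp only [receivedCovariance_update_zero] at h
    exact h
  · obtain ⟨Q, hQ⟩ := exists_isNashEquilibrium hL hρ.le hPbar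
    refine ⟨Q, hQ, fun Q' hQ' => hQ'.eq_of_isGaussianFading hH hρ (fun k => ?_) hQ⟩
    obtain ⟨i, j, hij⟩ := hσ k
    exact ⟨i, j, hij.ne'⟩
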